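/- Let $(\Omega,\mathcal F,\mathbb P)$ be an atomless probability space, let $n\in\mathbb N$, and let $\mathcal M$ be the set of Borel probability measures on $\mathbb R$ (identified with their cdfs). For $\mathbf F=(F_1,\dots,F_n)\in\mathcal M^n$ let $\mathcal D_n(\mathbf F)$ be the set of the distributions of all sums $X_1+\dots+X_n$ of random variables $X_1,\dots,X_n$ on $\Omega$ with $X_i\sim F_i$ for $i=1,\dots,n$. The tuple $\mathbf F$ is called jointly mixable if $\mathcal D_n(\mathbf F)$ contains a point mass $\delta_x$ for some $x\in\mathbb R$. For $\mathbf x\in\mathbb R^n$ let $\mathbf T_{\mathbf x}(\mathbf F)=(T_{x_1}(F_1),\dots,T_{x_n}(F_n))$, where $T_y(F)$ is the distribution of $X+y$ for $X\sim F$; and for an $n\times n$ doubly stochastic matrix $\Lambda=(\Lambda_{ij})$ let $\Lambda\mathbf F=\big(\sum_{j=1}^n\Lambda_{1j}F_j,\dots,\sum_{j=1}^n\Lambda_{nj}F_j\big)$. Put $$\mathcal A_n(\mathbf F)=\{\Lambda\,\mathbf T_{\mathbf x}(\mathbf F):\ \Lambda \text{ an } n\times n \text{ doubly stochastic matrix},\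 \mathbf x\in\mathbb R^n,\ x_1+\dots+x_n=0\},$$ and let $\overline{\mathcal A_n(\mathbf F)}$ be the closure, with respect to (componentwise) weak convergence, of the convex hull of $\mathcal A_n(\mathbf F)$ in $\mathcal M^n$. Then for every $\mathbf G\in\mathcal M^n$ the following statements are equivalent. (i) $\mathbf G$ is jointly mixable. (ii) $\mathbf G\in\overline{\mathcal A_n(\delta_c,\dots,\delta_c)}$ for some $c\in\mathbb R$. (iii) $\mathbf G\in\overline{\mathcal A_n(\mathbf F)}$ for some jointly mixable $\mathbf F\in\mathcal M^n$. -/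

import Mathlib

open MeasureTheory
open scoped NNReal ENNReal

noncomputable section

/-- A measure is atomless if every measurable set of positive measure has a measurable subset
of strictly smaller positive measure. (This is stronger than Mathlib's `NoAtoms`, which only
asks singletons to be null.) -/
def Atomless {Ω : Type*} [MeasurableSpace Ω] (P : Measure Ω) : Prop :=
  ∀ A : Set Ω, MeasurableSet A → 0 < P A →
    ∃ B : Set Ω, MeasurableSet B ∧ B ⊆ A ∧ 0 < P B ∧ P B < P A

/-- The aggregation set `D_n(F)` over the probability space `(Ω, P)`: all distributions of
`X_1 + ⋯ + X_n`, where `X_1, …, X_n` are random variables on `Ω` with `X_i ∼ F_i`. -/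
def aggregationSet {Ω : Type*} [MeasurableSpace Ω] (P : Measure Ω) {n : ℕ}
    (F : Fin n → ProbabilityMeasure ℝ) : Set (ProbabilityMeasure ℝ) :=
  {H | ∃ X : Fin n → Ω → ℝ, (∀ i, Measurable (X i)) ∧
    (∀ i, P.map (X i) = (F i : Measure ℝ)) ∧
    P.map (fun ω => ∑ i, X i ω) = (H : Measure ℝ)}

/-- `F` is jointly mixable if its aggregation set contains a point mass. -/
def JointlyMixable {Ω : Type*} [MeasurableSpace Ω] (P : Measure Ω) {n : ℕ}
    (F : Fin n → ProbabilityMeasure ℝ) : Prop :=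
  ∃ x : ℝ, diracProba x ∈ aggregationSet P F

/-- The location shift `T_x(F) = (T_{x_1}(F_1), …, T_{x_n}(F_n))`, where `T_y(H)` is the
distribution of `X + y` for `X ∼ H`. -/
def shift {n : ℕ} (x : Fin n → ℝ) (F : Fin n → ProbabilityMeasure ℝ) :
    Fin n → ProbabilityMeasure ℝ :=
  fun i => (F i).map (f := fun t => t + x i) (measurable_add_const (x i)).aemeasurable

/-- The `Λ`-mixture `ΛF` of `F`, for a doubly stochastic matrix `Λ`; its `i`-th component is
`∑ j, Λ i j F_j`. -/
def mixture {n : ℕ} (Λ : Matrix (Fin n) (Fin n) ℝ) (hΛ : Λ ∈ doublyStochastic ℝ (Fin n))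
    (F : Fin n → ProbabilityMeasure ℝ) : Fin n → ProbabilityMeasure ℝ :=
  fun i => ⟨∑ j, ENNReal.ofReal (Λ i j) • (F j : Measure ℝ), ⟨by
    have h : ∑ j, ENNReal.ofReal (Λ i j) = 1 := by
      rw [← ENNReal.ofReal_sum_of_nonneg (fun j _ => nonneg_of_mem_doublyStochastic hΛ),
        sum_row_of_mem_doublyStochastic hΛ i, ENNReal.ofReal_one]
    simpa [Measure.finsetSum_apply] using h⟩⟩

/-- The set `A_n(F)` of averagings and zero-sum location shifts of `F`. -/
def averagingShifts {n : ℕ} (F : Fin n → ProbabilityMeasure ℝ) :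
    Set (Fin n → ProbabilityMeasure ℝ) :=
  {G | ∃ (Λ : Matrix (Fin n) (Fin n) ℝ) (hΛ : Λ ∈ doublyStochastic ℝ (Fin n)) (x : Fin n → ℝ),
    ∑ i, x i = 0 ∧ G = mixture Λ hΛ (shift x F)}

/-- The convex hull of a set of `n`-tuples of probability measures, formed in the space of
`n`-tuples of finite measures with its componentwise addition and scaling. -/
def tupleConvexHull {n : ℕ} (S : Set (Fin n → ProbabilityMeasure ℝ)) :
    Set (Fin n → ProbabilityMeasure ℝ) :=
  {G | (fun i => (G i).toFiniteMeasure) ∈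
    convexHull ℝ≥0 ((fun (H : Fin n → ProbabilityMeasure ℝ) i => (H i).toFiniteMeasure) '' S)}

/-- The closure of the convex hull of `A_n(F)` with respect to weak convergence: the topology
on `ProbabilityMeasure ℝ` is that of weak convergence, and tuples carry the product topology. -/
def closedAveragingShifts {n : ℕ} (F : Fin n → ProbabilityMeasure ℝ) :
    Set (Fin n → ProbabilityMeasure ℝ) :=
  closure (tupleConvexHull (averagingShifts F))

end

/-! Over an atomless space every law on `ℝⁿ` is the law of a random vector, so joint mixability of
`G` means that some coupling of the `G i` lives on a hyperplane `∑ i, y i = C`: this is `mixableSet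
n C`. That set is stable under zero-sum shifts, mixtures (hence, by Birkhoff, doubly stochastic
averaging) and weak limits (`isClosed_mixableSet`, by Prokhorov), which gives (iii) ⇒ (i). For (i) ⇒
(ii), `mixableSet_subset_closedAveragingShifts` approximates the coupling by finitely supported ones
on the same hyperplane. These are convex combinations of tuples of point masses with coordinate sum
`C = n * c`, that is, of zero-sum shifts of `(δ_c, …, δ_c)`. (ii) ⇒ (iii) holds because `(δ_c, …,
δ_c)` is itself jointly mixable. -/

/-! ### Atomless measures take every value in `[0, 1]` along a nested family. -/

/-- `A` is contained in `B` and has strictly smaller measure. -/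
def StrictSub {Ω : Type*} [MeasurableSpace Ω] (P : Measure Ω) (A B : Set Ω) : Prop :=
  A ⊆ B ∧ P.real A < P.real B

/-- A maximal family of measurable sets any two distinct members of which are nested and have
different measures. -/
structure IsMaxNested {Ω : Type*} [MeasurableSpace Ω] (P : Measure Ω) (𝒞 : Set (Set Ω)) :
    Prop where
  measurableSet : ∀ C ∈ 𝒞, MeasurableSet C
  nested : ∀ C ∈ 𝒞, ∀ D ∈ 𝒞, C = D ∨ StrictSub P C D ∨ StrictSub P D C
  maximal : ∀ B, MeasurableSet B →
    (∀ C ∈ 𝒞, C = B ∨ StrictSub P C B ∨ StrictSub P B C) → B ∈ 𝒞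

theorem exists_isMaxNested {Ω : Type*} [MeasurableSpace Ω] (P : Measure Ω) :
    ∃ 𝒞, IsMaxNested P 𝒞 := by
  let r : {A : Set Ω // MeasurableSet A} → {A : Set Ω // MeasurableSet A} → Prop :=
    fun A B => StrictSub P A B
  have hm : IsMaxChain r (maxChain r) := maxChain_spec
  refine ⟨Subtype.val '' maxChain r, ?_, ?_, ?_⟩
  · rintro _ ⟨C, -, rfl⟩
    exact C.2
  · rintro _ ⟨C, hC, rfl⟩ _ ⟨D, hD, rfl⟩
    by_cases h : C = D
    · exact Or.inl (congrArg _ h)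
    · exact Or.inr (hm.1 hC hD h)
  · intro B hB h
    refine ⟨⟨B, hB⟩, ?_, rfl⟩
    have hins : IsChain r (insert ⟨B, hB⟩ (maxChain r)) := by
      refine hm.1.insert fun C hC hne => ?_
      rcases h C ⟨C, hC, rfl⟩ with h | h | h
      · exact absurd (Subtype.ext h.symm) hne
      · exact Or.inr h
      · exact Or.inl h
    rw [hm.2 hins (Set.subset_insert _ _)]
    exact Set.mem_insert _ _

namespace IsMaxNested

variable {Ω : Type*} [MeasurableSpace Ω] {P : Measure Ω} {𝒞 : Set (Set Ω)}

theorem strictSub_of_lt (h : IsMaxNested P 𝒞) {C D : Set Ω} (hC : C ∈ 𝒞) (hD : D ∈ 𝒞)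
    (hlt : P.real C < P.real D) : StrictSub P C D := by
  rcases h.nested C hC D hD with rfl | h | h
  · exact absurd hlt (lt_irrefl _)
  · exact h
  · exact absurd hlt h.2.not_gt

theorem subset_of_le (h : IsMaxNested P 𝒞) {C D : Set Ω} (hC : C ∈ 𝒞) (hD : D ∈ 𝒞)
    (hle : P.real C ≤ P.real D) : C ⊆ D := by
  rcases h.nested C hC D hD with rfl | h | h
  · exact subset_rfl
  · exact h.1
  · exact absurd hle h.2.not_ge

/-- Complementation reverses the order, so statements about members below `t` transfer to members
above `t`. -/
theorem compl [IsProbabilityMeasure P] (h : IsMaxNested P 𝒞) :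
    IsMaxNested P {C | Cᶜ ∈ 𝒞} := by
  have hs : ∀ {A B : Set Ω}, MeasurableSet A → MeasurableSet B →
      StrictSub P Aᶜ Bᶜ → StrictSub P B A := by
    intro A B hA hB hAB
    refine ⟨Set.compl_subset_compl.1 hAB.1, ?_⟩
    have := hAB.2
    rw [probReal_compl_eq_one_sub hA, probReal_compl_eq_one_sub hB] at this
    linarith
  have hm : ∀ C ∈ {C | Cᶜ ∈ 𝒞}, MeasurableSet C := fun C hC => (h.measurableSet _ hC).of_compl
  refine ⟨hm, fun C hC D hD => ?_, fun B hB hcomp => ?_⟩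
  · rcases h.nested _ hC _ hD with h1 | h1 | h1
    · exact Or.inl (compl_injective h1)
    · exact Or.inr (Or.inr (hs (hm C hC) (hm D hD) h1))
    · exact Or.inr (Or.inl (hs (hm D hD) (hm C hC) h1))
  · refine h.maximal _ hB.compl fun C hC => ?_
    have hCm := h.measurableSet C hC
    rcases hcomp Cᶜ (by simpa using hC) with h1 | h1 | h1
    · exact Or.inl (by rw [← h1, compl_compl])
    · exact Or.inr (Or.inr (hs hCm hB.compl (by rwa [compl_compl])))
    · exact Or.inr (Or.inl (hs hB.compl hCm (by rwa [compl_compl])))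

theorem exists_greatest_le [IsProbabilityMeasure P] (h : IsMaxNested P 𝒞) {t : ℝ} (ht : 0 ≤ t) :
    ∃ B ∈ 𝒞, P.real B ≤ t ∧ ∀ C ∈ 𝒞, P.real C ≤ t → P.real C ≤ P.real B := by
  by_contra! hcon
  let S : Set ℝ := P.real '' {C ∈ 𝒞 | P.real C ≤ t}
  -- If all members had measure above `t`, the empty set would be comparable to all of them, hence a
  -- member.
  have hne : S.Nonempty := by
    by_contra hS
    have hgt : ∀ C ∈ 𝒞, t < P.real C := fun C hC => by
      by_contra! hle
      exact hS ⟨_, C, ⟨hC, hle⟩, rfl⟩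
    have hmem : (∅ : Set Ω) ∈ 𝒞 := h.maximal _ MeasurableSet.empty fun C hC =>
      Or.inr (Or.inr ⟨Set.empty_subset _, by simpa using ht.trans_lt (hgt C hC)⟩)
    have := hgt _ hmem
    simp at this
    linarith
  have hbdd : BddAbove S := ⟨t, by rintro _ ⟨C, hC, rfl⟩; exact hC.2⟩
  obtain ⟨u, hu, hlim, huS⟩ := exists_seq_tendsto_sSup hne hbdd
  choose C hC hCu using huS
  have hmono : Monotone C := fun k l hkl =>
    h.subset_of_le (hC k).1 (hC l).1 (by rw [hCu, hCu]; exact hu hkl)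
  have hBm : MeasurableSet (⋃ k, C k) := .iUnion fun k => h.measurableSet _ (hC k).1
  have hPB : P.real (⋃ k, C k) = sSup S := by
    have h1 := tendsto_measure_iUnion_atTop (μ := P) hmono
    have h2 := (ENNReal.tendsto_toReal (measure_ne_top P (⋃ k, C k))).comp h1
    refine tendsto_nhds_unique h2 ?_
    convert hlim using 1
    ext k
    exact hCu k
  have hle : P.real (⋃ k, C k) ≤ t := by
    rw [hPB]
    exact csSup_le hne (by rintro _ ⟨C, hC, rfl⟩; exact hC.2)
  -- With no greatest member below `t`, each such member has measure strictly below the supremum, so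
  -- lies in some `C k`; the union is thus comparable to all members.
  have hB : (⋃ k, C k) ∈ 𝒞 := by
    refine h.maximal _ hBm fun D hD => ?_
    by_cases hDt : P.real D ≤ t
    · obtain ⟨D', hD', hD't, hlt⟩ := hcon D hD hDt
      have hlt' : P.real D < sSup S := hlt.trans_le (le_csSup hbdd ⟨D', ⟨hD', hD't⟩, rfl⟩)
      obtain ⟨k, hk⟩ := (hlim.eventually (lt_mem_nhds hlt')).exists
      rw [← hCu] at hk
      exact Or.inr (Or.inl ⟨(h.strictSub_of_lt hD (hC k).1 hk).1.trans (Set.subset_iUnion _ k),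
        by rwa [hPB]⟩)
    · push Not at hDt
      exact Or.inr (Or.inr ⟨Set.iUnion_subset fun k =>
        (h.strictSub_of_lt (hC k).1 hD ((hC k).2.trans_lt hDt)).1, hle.trans_lt hDt⟩)
  obtain ⟨D', hD', hD't, hlt⟩ := hcon _ hB hle
  rw [hPB] at hlt
  exact hlt.not_ge (le_csSup hbdd ⟨D', ⟨hD', hD't⟩, rfl⟩)

theorem exists_least_ge [IsProbabilityMeasure P] (h : IsMaxNested P 𝒞) {t : ℝ} (ht : t ≤ 1) :
    ∃ D ∈ 𝒞, t ≤ P.real D ∧ ∀ C ∈ 𝒞, t ≤ P.real C → P.real D ≤ P.real C := by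
  obtain ⟨B, hB, hBt, hmax⟩ := h.compl.exists_greatest_le (sub_nonneg.2 ht)
  have hBm := h.compl.measurableSet B hB
  refine ⟨Bᶜ, hB, ?_, fun C hC hCt => ?_⟩
  · rw [probReal_compl_eq_one_sub hBm]
    linarith
  · have hCm := h.measurableSet C hC
    have := hmax Cᶜ (by simpa using hC) (by rw [probReal_compl_eq_one_sub hCm]; linarith)
    rw [probReal_compl_eq_one_sub hCm] at this
    rw [probReal_compl_eq_one_sub hBm]
    linarith

/-- If `t` were skipped, atomlessness would split the gap `D \ B` between the neighbours of `t`. The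
resulting `B ∪ E` would be a member strictly between them. -/
theorem exists_measureReal_eq [IsProbabilityMeasure P] (h : IsMaxNested P 𝒞) (hP : Atomless P)
    {t : ℝ} (ht0 : 0 ≤ t) (ht1 : t ≤ 1) : ∃ C ∈ 𝒞, P.real C = t := by
  obtain ⟨B, hB, hBt, hmax⟩ := h.exists_greatest_le ht0
  obtain ⟨D, hD, hDt, hmin⟩ := h.exists_least_ge ht1
  rcases hBt.eq_or_lt with hBt | hBt
  · exact ⟨B, hB, hBt⟩
  rcases hDt.eq_or_lt with hDt | hDt
  · exact ⟨D, hD, hDt.symm⟩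
  exfalso
  have hBm := h.measurableSet B hB
  have hDm := h.measurableSet D hD
  have hBD := h.strictSub_of_lt hB hD (hBt.trans hDt)
  have hdiff : P.real (D \ B) = P.real D - P.real B := measureReal_sdiff hBD.1 hBm
  obtain ⟨E, hEm, hED, hE0, hElt⟩ := hP (D \ B) (hDm.diff hBm)
    (ENNReal.toReal_pos_iff.1 (show 0 < P.real (D \ B) by linarith [hBD.2])).1
  have hE0' : 0 < P.real E := ENNReal.toReal_pos hE0.ne' (by finiteness)
  have hElt' : P.real E < P.real (D \ B) := (ENNReal.toReal_lt_toReal (by finiteness)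
    (by finiteness)).2 hElt
  have hsum : P.real (B ∪ E) = P.real B + P.real E :=
    measureReal_union (Set.disjoint_left.2 fun x hx hxE => (hED hxE).2 hx) hEm
  have hsub : B ∪ E ⊆ D := Set.union_subset hBD.1 fun x hx => (hED hx).1
  have hmem : B ∪ E ∈ 𝒞 := by
    refine h.maximal _ (hBm.union hEm) fun C hC => ?_
    rcases le_total (P.real C) t with hCt | hCt
    · have hle := hmax C hC hCt
      exact Or.inr (Or.inl ⟨(h.subset_of_le hC hB hle).trans Set.subset_union_left, by linarith⟩)
    · have hle := hmin C hC hCt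
      exact Or.inr (Or.inr ⟨hsub.trans (h.subset_of_le hD hC hle), by linarith⟩)
  rcases le_total (P.real (B ∪ E)) t with hle | hle
  · linarith [hmax _ hmem hle]
  · linarith [hmin _ hmem hle]

end IsMaxNested

/-! ### Random variables with prescribed law on an atomless space. -/

namespace Atomless

variable {Ω : Type*} [MeasurableSpace Ω] {P : Measure Ω} [IsProbabilityMeasure P]

theorem exists_monotone_measure_eq (hP : Atomless P) :
    ∃ A : unitInterval → Set Ω, (∀ t, MeasurableSet (A t)) ∧ Monotone A ∧
      ∀ t, P (A t) = ENNReal.ofReal t := by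
  obtain ⟨𝒞, h⟩ := exists_isMaxNested P
  choose A hA hAt using fun t : unitInterval => h.exists_measureReal_eq hP t.2.1 t.2.2
  refine ⟨A, fun t => h.measurableSet _ (hA t), fun s t hst =>
    h.subset_of_le (hA s) (hA t) (by rw [hAt, hAt]; exact hst), fun t => ?_⟩
  rw [← hAt t, ofReal_measureReal]

/-- An atomless probability space carries a random variable uniform on the unit interval. -/
theorem exists_map_eq_volume (hP : Atomless P) :
    ∃ U : Ω → unitInterval, Measurable U ∧ P.map U = volume := by
  classical
  obtain ⟨A, hAm, hmono, hA⟩ := hP.exists_monotone_measure_eq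
  obtain ⟨Q, hQc, hQd⟩ := TopologicalSpace.exists_countable_dense unitInterval
  have := hQc.to_subtype
  -- The value `1` is the top of the interval, so indices `q` with `ω ∉ A q` do not affect the
  -- infimum.
  let U : Ω → unitInterval := fun ω => ⨅ q : Q, if ω ∈ A q then (q : unitInterval) else 1
  have hU : Measurable U := Measurable.iInf fun q =>
    Measurable.ite (hAm q) measurable_const measurable_const
  have hlt : ∀ ω t, U ω < t ↔ ∃ q ∈ Q, q < t ∧ ω ∈ A q := by
    intro ω t
    simp only [U, iInf_lt_iff]
    constructor
    · rintro ⟨q, hq⟩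
      split_ifs at hq with hω
      · exact ⟨q, q.2, hq, hω⟩
      · exact absurd hq (unitInterval.le_one t).not_gt
    · rintro ⟨q, hqQ, hq, hω⟩
      exact ⟨⟨q, hqQ⟩, by simpa [hω] using hq⟩
  refine ⟨U, hU, ?_⟩
  have := Measure.isProbabilityMeasure_map (μ := P) hU.aemeasurable
  refine Measure.ext_of_Ici _ _ fun t => ?_
  rw [← Set.compl_Iio, prob_compl_eq_one_sub measurableSet_Iio,
    prob_compl_eq_one_sub measurableSet_Iio, unitInterval.volume_Iio,
    Measure.map_apply hU measurableSet_Iio]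
  congr 1
  -- The event `U < t` lies inside `A t` and contains `A q` for every `q ∈ Q` below `t`.
  refine le_antisymm ?_ ?_
  · rw [← hA t]
    refine measure_mono fun ω hω => ?_
    obtain ⟨q, -, hq, hωq⟩ := (hlt ω t).1 hω
    exact hmono hq.le hωq
  · refine le_of_forall_lt fun c hc => ?_
    have hc' : c.toReal < t := by
      rwa [← ENNReal.lt_ofReal_iff_toReal_lt hc.ne_top]
    have hcI : c.toReal ∈ unitInterval := ⟨ENNReal.toReal_nonneg, hc'.le.trans t.2.2⟩
    obtain ⟨q, hqQ, hcq, hqt⟩ := hQd.exists_between (show (⟨c.toReal, hcI⟩ : unitInterval) < t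
      from hc')
    have : c < ENNReal.ofReal q := (ENNReal.lt_ofReal_iff_toReal_lt hc.ne_top).2 hcq
    rw [← hA q] at this
    exact this.trans_le (measure_mono fun ω hω => (hlt ω t).2 ⟨q, hqQ, hqt, hω⟩)

theorem exists_measurable_map_eq (hP : Atomless P) {E : Type*} [MeasurableSpace E]
    [StandardBorelSpace E] (μ : Measure E) [IsProbabilityMeasure μ] :
    ∃ X : Ω → E, Measurable X ∧ P.map X = μ := by
  have : Nonempty E := nonempty_of_isProbabilityMeasure μ
  obtain ⟨U, hU, hPU⟩ := hP.exists_map_eq_volume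
  obtain ⟨f, hf, hfμ⟩ := μ.exists_measurable_map_eq
  exact ⟨f ∘ U, hf.comp hU, by rw [← Measure.map_map hf hU, hPU, hfμ]⟩

end Atomless

/-! ### Joint mixability as a coupling on a hyperplane, and its stability. -/

open Filter Topology

variable {n : ℕ}

/-- The tuples of marginals of the probability measures on `ℝⁿ` that are carried by the
hyperplane `∑ i, y i = C`. -/
def mixableSet (n : ℕ) (C : ℝ) : Set (Fin n → ProbabilityMeasure ℝ) :=
  {G | ∃ μ : Measure (Fin n → ℝ), IsProbabilityMeasure μ ∧
    (∀ i, μ.map (fun y => y i) = (G i : Measure ℝ)) ∧ ∀ᵐ y ∂μ, ∑ i, y i = C}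

theorem map_eq_dirac_iff {α : Type*} [MeasurableSpace α] {μ : Measure α} [IsProbabilityMeasure μ]
    {f : α → ℝ} (hf : Measurable f) {c : ℝ} :
    μ.map f = Measure.dirac c ↔ ∀ᵐ a ∂μ, f a = c := by
  constructor
  · intro h
    have : ∀ᵐ b ∂(μ.map f), b = c := by
      rw [h, ae_dirac_iff (p := fun b => b = c) (measurableSet_singleton c)]
    exact ae_of_ae_map hf.aemeasurable this
  · intro h
    have h' : f =ᵐ[μ] fun _ => c := h
    rw [Measure.map_congr h', Measure.map_const, measure_univ, one_smul]

/-- The coupling is the joint law of the `X i`; atomlessness serves to realise a given coupling on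
`Ω`. -/
theorem jointlyMixable_iff {Ω : Type*} [MeasurableSpace Ω] {P : Measure Ω}
    [IsProbabilityMeasure P] (hP : Atomless P) {G : Fin n → ProbabilityMeasure ℝ} :
    JointlyMixable P G ↔ ∃ C, G ∈ mixableSet n C := by
  have hsum : Measurable fun y : Fin n → ℝ => ∑ i, y i := by fun_prop
  refine exists_congr fun C => ⟨?_, ?_⟩
  · rintro ⟨X, hX, hXG, hXC⟩
    have hXm : Measurable fun ω i => X i ω := measurable_pi_lambda _ hX
    refine ⟨P.map fun ω i => X i ω, Measure.isProbabilityMeasure_map hXm.aemeasurable,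
      fun i => ?_, ?_⟩
    · rw [Measure.map_map (measurable_pi_apply i) hXm, ← hXG i]
      rfl
    · have := Measure.isProbabilityMeasure_map (μ := P) hXm.aemeasurable
      rw [← map_eq_dirac_iff hsum, Measure.map_map hsum hXm]
      exact hXC
  · rintro ⟨μ, hμ, hμG, hμC⟩
    obtain ⟨X, hX, hXμ⟩ := hP.exists_measurable_map_eq μ
    refine ⟨fun i ω => X ω i, fun i => (measurable_pi_apply i).comp hX, fun i => ?_, ?_⟩
    · rw [← hμG i, ← hXμ, Measure.map_map (measurable_pi_apply i) hX]
      rfl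
    · rw [← map_eq_dirac_iff hsum, ← hXμ, Measure.map_map hsum hX] at hμC
      exact hμC

theorem mixableSet_of_sum {C : ℝ} {ι : Type*} [Fintype ι] {w : ι → ℝ≥0∞} (hw : ∑ k, w k = 1)
    {H : ι → Fin n → ProbabilityMeasure ℝ} (hH : ∀ k, H k ∈ mixableSet n C)
    {G : Fin n → ProbabilityMeasure ℝ}
    (hG : ∀ i, (G i : Measure ℝ) = ∑ k, w k • (H k i : Measure ℝ)) : G ∈ mixableSet n C := by
  choose μ hμ hμH hμC using hH
  refine ⟨∑ k, w k • μ k, ⟨?_⟩, fun i => ?_, ?_⟩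
  · simp [Measure.finsetSum_apply, hw]
  · rw [hG i, ← Measure.mapₗ_apply_of_measurable (measurable_pi_apply i), map_sum]
    refine Finset.sum_congr rfl fun k _ => ?_
    rw [Measure.mapₗ_apply_of_measurable (measurable_pi_apply i), Measure.map_smul, hμH]
  · have hm : MeasurableSet {y : Fin n → ℝ | ¬ ∑ i, y i = C} :=
      (measurableSet_eq_fun (by fun_prop) measurable_const).compl
    rw [ae_iff, Measure.finsetSum_apply]
    exact Finset.sum_eq_zero fun k _ => by
      rw [Measure.smul_apply, ae_iff.1 (hμC k), smul_zero]

theorem mixableSet_comp_perm {C : ℝ} {G : Fin n → ProbabilityMeasure ℝ} (hG : G ∈ mixableSet n C)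
    (σ : Equiv.Perm (Fin n)) : (fun i => G (σ i)) ∈ mixableSet n C := by
  obtain ⟨μ, hμ, hμG, hμC⟩ := hG
  have hm : Measurable fun (y : Fin n → ℝ) i => y (σ i) := by fun_prop
  refine ⟨μ.map fun y i => y (σ i), Measure.isProbabilityMeasure_map hm.aemeasurable,
    fun i => ?_, ?_⟩
  · rw [Measure.map_map (measurable_pi_apply i) hm]
    exact hμG (σ i)
  · rw [ae_map_iff hm.aemeasurable (measurableSet_eq_fun (by fun_prop) measurable_const)]
    filter_upwards [hμC] with y hy
    rw [← hy]
    exact Equiv.sum_comp σ y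

theorem shift_mem_mixableSet {C : ℝ} {G : Fin n → ProbabilityMeasure ℝ} (hG : G ∈ mixableSet n C)
    {x : Fin n → ℝ} (hx : ∑ i, x i = 0) : shift x G ∈ mixableSet n C := by
  obtain ⟨μ, hμ, hμG, hμC⟩ := hG
  have hm : Measurable fun (y : Fin n → ℝ) i => y i + x i := by fun_prop
  refine ⟨μ.map fun y i => y i + x i, Measure.isProbabilityMeasure_map hm.aemeasurable,
    fun i => ?_, ?_⟩
  · rw [Measure.map_map (measurable_pi_apply i) hm, shift, ProbabilityMeasure.toMeasure_map,
      ← hμG i, Measure.map_map (measurable_add_const (x i)) (measurable_pi_apply i)]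
    rfl
  · rw [ae_map_iff hm.aemeasurable (measurableSet_eq_fun (by fun_prop) measurable_const)]
    filter_upwards [hμC] with y hy
    rw [Finset.sum_add_distrib, hx, hy, add_zero]

/-- By Birkhoff's theorem `Λ` is a convex combination of permutation matrices, and permuting
coordinates preserves the hyperplane. -/
theorem mixture_mem_mixableSet {C : ℝ} {G : Fin n → ProbabilityMeasure ℝ}
    (hG : G ∈ mixableSet n C) {Λ : Matrix (Fin n) (Fin n) ℝ}
    (hΛ : Λ ∈ doublyStochastic ℝ (Fin n)) : mixture Λ hΛ G ∈ mixableSet n C := by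
  obtain ⟨w, hw0, hw1, hwΛ⟩ := exists_eq_sum_perm_of_mem_doublyStochastic hΛ
  refine mixableSet_of_sum (w := fun σ => ENNReal.ofReal (w σ)) ?_
    (fun σ => mixableSet_comp_perm hG σ) fun i => ?_
  · rw [← ENNReal.ofReal_sum_of_nonneg fun σ _ => hw0 σ, hw1, ENNReal.ofReal_one]
  · have hentry : ∀ j, ENNReal.ofReal (Λ i j) =
        ∑ σ : Equiv.Perm (Fin n), if σ i = j then ENNReal.ofReal (w σ) else 0 := by
      intro j
      have : Λ i j = ∑ σ : Equiv.Perm (Fin n), if σ i = j then w σ else 0 := by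
        rw [← hwΛ, Matrix.sum_apply]
        refine Finset.sum_congr rfl fun σ _ => ?_
        simp [Equiv.toPEquiv_apply, eq_comm]
      rw [this, ENNReal.ofReal_sum_of_nonneg]
      · refine Finset.sum_congr rfl fun σ _ => ?_
        split_ifs <;> simp
      · intro σ _
        split_ifs
        exacts [hw0 σ, le_rfl]
    change ∑ j, ENNReal.ofReal (Λ i j) • (G j : Measure ℝ) = _
    simp_rw [hentry, Finset.sum_smul, ite_smul, zero_smul]
    rw [Finset.sum_comm]
    simp

theorem tupleConvexHull_subset_mixableSet {C : ℝ} {S : Set (Fin n → ProbabilityMeasure ℝ)}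
    (hS : S ⊆ mixableSet n C) : tupleConvexHull S ⊆ mixableSet n C := by
  intro G hG
  let e : (Fin n → ProbabilityMeasure ℝ) → Fin n → FiniteMeasure ℝ :=
    fun H i => (H i).toFiniteMeasure
  have hconv : Convex ℝ≥0 (e '' mixableSet n C) := by
    rintro _ ⟨H, hH, rfl⟩ _ ⟨K, hK, rfl⟩ a b - - hab
    have hab' : (a : ℝ≥0∞) + b = 1 := by exact_mod_cast hab
    let L : Fin n → ProbabilityMeasure ℝ := fun i =>
      ⟨(a : ℝ≥0∞) • (H i : Measure ℝ) + (b : ℝ≥0∞) • (K i : Measure ℝ), ⟨by simp [hab']⟩⟩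
    refine ⟨L, ?_, ?_⟩
    · refine mixableSet_of_sum (ι := Fin 2) (w := ![(a : ℝ≥0∞), b]) (H := ![H, K])
        (by simpa using hab') (fun k => ?_) (fun i => ?_)
      · fin_cases k
        exacts [hH, hK]
      · simp [L]
    · funext i
      exact Subtype.ext rfl
  obtain ⟨H, hH, hHG⟩ := convexHull_min (Set.image_mono hS) hconv hG
  convert hH
  funext i
  exact ((ProbabilityMeasure.toFiniteMeasure_isEmbedding ℝ).injective (congrFun hHG i)).symm

/-! ### Weak closedness. -/

/-- Convergent marginals are tight, hence so are their couplings. A subsequential limit of couplings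
has the limit marginals, and its sum has law `δ_C` by continuity of the sum. -/
theorem isClosed_mixableSet (C : ℝ) : IsClosed (mixableSet n C) := by
  refine IsSeqClosed.isClosed fun G G₀ hG hlim => ?_
  choose μ hμ hμG hμC using hG
  let M : ℕ → ProbabilityMeasure (Fin n → ℝ) := fun k => ⟨μ k, hμ k⟩
  have hlim' : ∀ i, Tendsto (fun k => G k i) atTop (𝓝 (G₀ i)) := fun i =>
    ((continuous_apply i).tendsto G₀).comp hlim
  have htight : ∀ i, IsTightMeasureSet
      {((ν : ProbabilityMeasure ℝ) : Measure ℝ) | ν ∈ Set.range fun k => G k i} := fun i =>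
    isTightMeasureSet_of_isCompact_closure <|
      (hlim' i).isCompact_insert_range.closure_of_subset (Set.subset_insert _ _)
  have hMtight : IsTightMeasureSet
      {((ν : ProbabilityMeasure (Fin n → ℝ)) : Measure (Fin n → ℝ)) | ν ∈ Set.range M} := by
    rw [isTightMeasureSet_iff_exists_isCompact_measure_compl_le]
    intro ε hε
    -- The budget `ε / n` per coordinate needs `n ≠ 0`; for `n = 0` the space is a point.
    rcases Nat.eq_zero_or_pos n with rfl | hn
    · exact ⟨Set.univ, isCompact_univ, by simp⟩
    have hn' : (n : ℝ≥0∞) ≠ 0 := by exact_mod_cast hn.ne'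
    choose K hK hKε using fun i => isTightMeasureSet_iff_exists_isCompact_measure_compl_le.1
      (htight i) (ε / n) (ENNReal.div_pos hε.ne' (by finiteness))
    refine ⟨Set.univ.pi K, isCompact_univ_pi hK, ?_⟩
    rintro _ ⟨_, ⟨k, rfl⟩, rfl⟩
    calc μ k (Set.univ.pi K)ᶜ ≤ μ k (⋃ i, (fun y : Fin n → ℝ => y i) ⁻¹' (K i)ᶜ) := by
          refine measure_mono fun y hy => ?_
          simpa [Set.mem_pi] using hy
      _ ≤ ∑ i, μ k ((fun y : Fin n → ℝ => y i) ⁻¹' (K i)ᶜ) := measure_iUnion_fintype_le _ _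
      _ ≤ ∑ _i : Fin n, ε / n := by
          refine Finset.sum_le_sum fun i _ => ?_
          rw [← Measure.map_apply (measurable_pi_apply i) (hK i).measurableSet.compl, hμG]
          exact hKε i _ ⟨_, ⟨k, rfl⟩, rfl⟩
      _ = ε := by simp [ENNReal.mul_div_cancel hn' (by finiteness)]
  obtain ⟨ν, -, φ, hφ, hν⟩ := (isCompact_closure_of_isTightMeasureSet hMtight).isSeqCompact
    (x := M) fun k => subset_closure ⟨k, rfl⟩
  refine ⟨ν, inferInstance, fun i => ?_, ?_⟩
  · have h1 := ProbabilityMeasure.tendsto_map_of_tendsto_of_continuous _ _ hν (continuous_apply i)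
    have h2 := (hlim' i).comp hφ.tendsto_atTop
    have h3 := tendsto_nhds_unique h1 (h2.congr fun k => Subtype.ext (hμG (φ k) i).symm)
    exact congrArg Subtype.val h3
  · have hc : Continuous fun y : Fin n → ℝ => ∑ i, y i := by fun_prop
    have h1 := ProbabilityMeasure.tendsto_map_of_tendsto_of_continuous _ _ hν hc
    have h2 : Tendsto (fun _ : ℕ => diracProba C) atTop (𝓝 (diracProba C)) := tendsto_const_nhds
    have h3 := tendsto_nhds_unique h1 (h2.congr fun k =>
      Subtype.ext ((map_eq_dirac_iff hc.measurable).2 (hμC (φ k))).symm)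
    exact (map_eq_dirac_iff hc.measurable).1 (congrArg Subtype.val h3)

theorem closedAveragingShifts_subset_mixableSet {C : ℝ} {F : Fin n → ProbabilityMeasure ℝ}
    (hF : F ∈ mixableSet n C) : closedAveragingShifts F ⊆ mixableSet n C := by
  refine closure_minimal (tupleConvexHull_subset_mixableSet ?_) (isClosed_mixableSet C)
  rintro _ ⟨Λ, hΛ, x, hx, rfl⟩
  exact mixture_mem_mixableSet (shift_mem_mixableSet hF hx) hΛ

/-! ### Approximation by finite mixtures of point masses. -/

theorem Convex.nnreal_sum_mem {E ι : Type*} [AddCommMonoid E] [Module ℝ≥0 E] {s : Set E}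
    (hs : Convex ℝ≥0 s) {t : Finset ι} {w : ι → ℝ≥0} {z : ι → E} (hw : ∑ k ∈ t, w k = 1)
    (hz : ∀ k ∈ t, z k ∈ s) : ∑ k ∈ t, w k • z k ∈ s := by
  classical
  -- Weights of a subfamily need not sum to `1`, so the induction uses unnormalised sums of nonzero
  -- total weight.
  suffices h : ∀ t : Finset ι, (∀ k ∈ t, z k ∈ s) → ∑ k ∈ t, w k ≠ 0 →
      ∃ y ∈ s, ∑ k ∈ t, w k • z k = (∑ k ∈ t, w k) • y by
    obtain ⟨y, hy, h⟩ := h t hz (by simp [hw])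
    rwa [h, hw, one_smul]
  intro t
  induction t using Finset.induction_on with
  | empty => simp
  | insert a t ha ih =>
    intro hz hne
    rw [Finset.sum_insert ha] at hne
    rw [Finset.sum_insert ha, Finset.sum_insert ha]
    have hza := hz a (Finset.mem_insert_self _ _)
    by_cases h0 : ∑ k ∈ t, w k = 0
    · refine ⟨z a, hza, ?_⟩
      have hsum : ∑ k ∈ t, w k • z k = 0 := Finset.sum_eq_zero fun k hk => by
        rw [Finset.sum_eq_zero_iff.1 h0 k hk, zero_smul]
      rw [hsum, h0, add_zero, add_zero]
    · obtain ⟨y, hy, hyt⟩ := ih (fun k hk => hz k (Finset.mem_insert_of_mem hk)) h0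
      set W := ∑ k ∈ t, w k
      refine ⟨(w a / (w a + W)) • z a + (W / (w a + W)) • y,
        hs hza hy zero_le zero_le (by rw [← add_div, div_self hne]), ?_⟩
      rw [hyt, smul_add, smul_smul, smul_smul, mul_div_cancel₀ _ hne, mul_div_cancel₀ _ hne]

theorem dirac_mem_averagingShifts {c : ℝ} {y : Fin n → ℝ} (hy : ∑ i, y i = n * c) :
    (fun i => diracProba (y i)) ∈ averagingShifts (fun _ : Fin n => diracProba c) := by
  refine ⟨1, one_mem _, fun i => y i - c, by simp [Finset.sum_sub_distrib, hy], ?_⟩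
  funext i
  refine Subtype.ext ?_
  change Measure.dirac (y i) = ∑ j, ENNReal.ofReal ((1 : Matrix (Fin n) (Fin n) ℝ) i j) •
    (Measure.dirac c).map (fun t => t + (y j - c))
  simp only [Measure.map_dirac' (measurable_add_const _), add_sub_cancel]
  rw [Finset.sum_eq_single i]
  · simp
  · intro j _ hj
    simp [Matrix.one_apply_ne' hj]
  · simp

/-- The law of `f` is the mixture of the point masses at its finitely many values `z`, with weights
`μ (f ⁻¹' {z})`. -/
theorem mem_tupleConvexHull_of_simpleFunc {c : ℝ} {μ : Measure (Fin n → ℝ)}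
    [IsProbabilityMeasure μ] (f : SimpleFunc (Fin n → ℝ) (Fin n → ℝ))
    (hf : ∀ y, ∑ i, f y i = n * c) {G : Fin n → ProbabilityMeasure ℝ}
    (hG : ∀ i, (G i : Measure ℝ) = μ.map fun y => f y i) :
    G ∈ tupleConvexHull (averagingShifts (fun _ : Fin n => diracProba c)) := by
  classical
  let w : (Fin n → ℝ) → ℝ≥0 := fun z => (μ (f ⁻¹' {z})).toNNReal
  let D : (Fin n → ℝ) → Fin n → FiniteMeasure ℝ := fun z i => (diracProba (z i)).toFiniteMeasure
  have hwμ : ∀ z, (w z : ℝ≥0∞) = μ (f ⁻¹' {z}) := fun z => ENNReal.coe_toNNReal (by finiteness)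
  have hw : ∑ z ∈ f.range, w z = 1 := by
    have := f.sum_range_measure_preimage_singleton μ
    simp_rw [← hwμ, measure_univ] at this
    exact_mod_cast this
  have hsum : (fun i => (G i).toFiniteMeasure) = ∑ z ∈ f.range, w z • D z := by
    funext i
    refine Subtype.ext (Measure.ext fun B hB => ?_)
    have hm : Measurable fun y => f y i := (measurable_pi_apply i).comp f.measurable
    have hR : ((∑ z ∈ f.range, w z • D z) i : FiniteMeasure ℝ).1 =
        ∑ z ∈ f.range, (w z : ℝ≥0∞) • Measure.dirac (z i) := by
      rw [Finset.sum_apply]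
      exact FiniteMeasure.toMeasure_sum
    rw [hR, Measure.finsetSum_apply]
    change (G i : Measure ℝ) B = _
    rw [hG i, Measure.map_apply hm hB]
    have : (fun y => f y i) ⁻¹' B = f ⁻¹' ↑(f.range.filter fun z => z i ∈ B) := by
      ext y
      simp
    rw [this, ← f.sum_measure_preimage_singleton, Finset.sum_filter]
    refine Finset.sum_congr rfl fun z _ => ?_
    simp [hwμ, hB, Set.indicator_apply]
  rw [tupleConvexHull, Set.mem_ofPred_eq, hsum]
  refine (convex_convexHull ℝ≥0 _).nnreal_sum_mem hw fun z hz => subset_convexHull ℝ≥0 _ ?_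
  obtain ⟨y, rfl⟩ := SimpleFunc.mem_range.1 hz
  exact ⟨_, dirac_mem_averagingShifts (hf y), rfl⟩

theorem mixableSet_subset_closedAveragingShifts (c : ℝ) :
    mixableSet n (n * c) ⊆ closedAveragingShifts (fun _ : Fin n => diracProba c) := by
  rintro G ⟨μ, hμ, hμG, hμC⟩
  let s : Set (Fin n → ℝ) := {y | ∑ i, y i = n * c}
  have hs : (fun _ => c) ∈ s := by simp [s]
  -- Approximating within `s` keeps all values on the hyperplane; since `μ` is carried by `s`,
  -- convergence to the identity holds almost everywhere, hence in law.
  let f : ℕ → SimpleFunc (Fin n → ℝ) (Fin n → ℝ) :=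
    SimpleFunc.approxOn id measurable_id s _ hs
  have hfm : ∀ k i, Measurable fun y => f k y i := fun k i =>
    (measurable_pi_apply i).comp (f k).measurable
  let H : ℕ → Fin n → ProbabilityMeasure ℝ := fun k i =>
    ⟨μ.map fun y => f k y i, Measure.isProbabilityMeasure_map (hfm k i).aemeasurable⟩
  refine mem_closure_of_tendsto (f := H) (b := atTop) (tendsto_pi_nhds.2 fun i => ?_)
    (.of_forall fun k => mem_tupleConvexHull_of_simpleFunc (f k)
      (fun y => SimpleFunc.approxOn_mem measurable_id hs k y) fun i => rfl)
  have hae : ∀ᵐ y ∂μ, Tendsto (fun k => f k y i) atTop (𝓝 (y i)) := by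
    filter_upwards [hμC] with y hy
    exact ((continuous_apply i).tendsto y).comp
      (SimpleFunc.tendsto_approxOn measurable_id hs (subset_closure hy))
  have h := (tendstoInDistribution_of_ae_tendsto (fun k => (hfm k i).aemeasurable)
    (measurable_pi_apply i).aemeasurable hae).tendsto
  have hGi : G i = ⟨μ.map fun y => y i, Measure.isProbabilityMeasure_map
    (measurable_pi_apply i).aemeasurable⟩ := Subtype.ext (hμG i).symm
  rw [hGi]
  exact h

/-! ### The equivalence. -/

theorem dirac_mem_mixableSet (c : ℝ) :
    (fun _ : Fin n => diracProba c) ∈ mixableSet n (n * c) := by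
  refine ⟨Measure.dirac fun _ => c, inferInstance, fun i => ?_, ?_⟩
  · rw [Measure.map_dirac' (measurable_pi_apply i)]
    rfl
  · rw [ae_dirac_iff (measurableSet_eq_fun (by fun_prop) measurable_const)]
    simp

/-- Only `n = 0` needs the coupling: the empty sum then forces `C = 0`. -/
theorem exists_eq_mul_of_mem_mixableSet {C : ℝ} {G : Fin n → ProbabilityMeasure ℝ}
    (hG : G ∈ mixableSet n C) : ∃ c : ℝ, C = n * c := by
  rcases Nat.eq_zero_or_pos n with rfl | hn
  · obtain ⟨μ, hμ, -, hμC⟩ := hG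
    obtain ⟨y, hy⟩ := hμC.exists
    exact ⟨0, by simpa using hy.symm⟩
  · exact ⟨C / n, by field_simp⟩

theorem proposition11 {Ω : Type*} [MeasurableSpace Ω] (P : Measure Ω) [IsProbabilityMeasure P]
    (hP : Atomless P) (n : ℕ) (G : Fin n → ProbabilityMeasure ℝ) :
    List.TFAE
      [JointlyMixable P G,
       ∃ c : ℝ, G ∈ closedAveragingShifts (fun _ : Fin n => diracProba c),
       ∃ F : Fin n → ProbabilityMeasure ℝ, JointlyMixable P F ∧ G ∈ closedAveragingShifts F] := by
  tfae_have 1 → 2 := by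
    intro h
    obtain ⟨C, hC⟩ := (jointlyMixable_iff hP).1 h
    obtain ⟨c, rfl⟩ := exists_eq_mul_of_mem_mixableSet hC
    exact ⟨c, mixableSet_subset_closedAveragingShifts c hC⟩
  tfae_have 2 → 3 := fun ⟨c, hc⟩ =>
    ⟨_, (jointlyMixable_iff hP).2 ⟨_, dirac_mem_mixableSet c⟩, hc⟩
  tfae_have 3 → 1 := by
    rintro ⟨F, hF, hG⟩
    obtain ⟨C, hC⟩ := (jointlyMixable_iff hP).1 hF
    exact (jointlyMixable_iff hP).2 ⟨C, closedAveragingShifts_subset_mixableSet hC hG⟩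
  tfae_finish
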